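/- Let $n\ge 2$ and let $SD_{8n}=\langle a,b \mid a^{4n}=b^2=1,\ bab=a^{2n-1}\rangle$ be the semidihedral group of order $8n$. Let $G=SD_{8n}$ be viewed as a subgroup of $S_{4n}$, the group of permutations of the residues modulo $4n$, through the embedding $a\mapsto (t\mapsto t+1)$, $b\mapsto (t\mapsto (2n-1)t)$. Let $h\in C^{\dagger}_{even}=\{2,4,\dots,2n-2\}$, put $\omega=e^{i\pi/(2n)}$, and let $\varsigma=\varsigma_h$ be the character of the degree-$2$ irreducible representation $$\rho^h(a^r)=\begin{pmatrix}\omega^{hr}&0\\0&\omega^{(2n-1)hr}\end{pmatrix},\qquad \rho^h(ba^r)=\begin{pmatrix}0&\omega^{(2n-1)hr}\\ \omega^{hr}&0\end{pmatrix}$$ of $G$, so that $\varsigma_h(a^r)=2\cos\frac{hr\pi}{2n}$ and $\varsigma_h(ba^r)=0$. Let $V$ be a complex inner product space of finite dimension $d\ge 2$ with an orthonormal basis $e_1,\dots,e_d$, and let $\bigotimes_1^{4n}V$ carry the induced inner product, $\langle \otimes_i v_i,\otimes_i u_i\rangle=\prod_i\langle v_i,u_i\rangle$. For $\sigma\in G$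 let $P_\sigma$ be the linear operator on $\bigotimes_1^{4n}V$ with $P_\sigma(\otimes_i v_i)=\otimes_i v_{\sigma^{-1}(i)}$, and let $$T(G,\varsigma)=\frac{\varsigma(1)}{|G|}\sum_{\sigma\in G}\varsigma(\sigma)P_\sigma .$$ The symmetry class of tensors $V_\varsigma(G)$ is the image of $T(G,\varsigma)$, and for $\alpha\in\{1,\dots,d\}^{4n}$ put $e^*_\alpha=T(G,\varsigma)(\otimes_i e_{\alpha_i})$. Then $V_\varsigma(G)$ has an orthogonal basis consisting of tensors of the form $e^*_\alpha$ if and only if $\nu_2\!\left(\frac{h}{2n}\right)<0$, where $\nu_2$ is the $2$-adic valuation on $\mathbb{Q}$. Moreover, $\nu_2\!\left(\frac{h}{2n}\right)<0$ holds if and only if every power of $2$ that divides $h$ also divides $n$. -/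

import Mathlib

open scoped TensorProduct

/-- The semidihedral group `SD_{8n} = ⟨a, b ∣ a^{4n} = b² = 1, b a b = a^{2n-1}⟩`, through its
normal forms: `a r` is `a^r` and `ba r` is `b a^r`, with `r` taken modulo `4n`. -/
inductive SemiDihedral (n : ℕ) : Type
  | a : ZMod (4 * n) → SemiDihedral n
  | ba : ZMod (4 * n) → SemiDihedral n
  deriving DecidableEq

namespace SemiDihedral

variable {n : ℕ}

/-- The exponent `2n - 1` modulo `4n`. -/
def twist (n : ℕ) : ZMod (4 * n) := 2 * (n : ZMod (4 * n)) - 1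

theorem twist_mul_twist (n : ℕ) : twist n * twist n = 1 := by
  have h : (4 : ZMod (4 * n)) * n = 0 := by
    have := ZMod.natCast_self (4 * n)
    push_cast at this
    exact this
  unfold twist
  linear_combination ((n : ZMod (4 * n)) - 1) * h

theorem twist_twist (x : ZMod (4 * n)) : twist n * (twist n * x) = x := by
  rw [← mul_assoc, twist_mul_twist, one_mul]

/-- Multiplication of normal forms, by the rule `a^k b = b a^{(2n-1)k}`. -/
def mul : SemiDihedral n → SemiDihedral n → SemiDihedral n
  | a i, a j => a (i + j)
  | a i, ba j => ba (twist n * i + j)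
  | ba i, a j => ba (i + j)
  | ba i, ba j => a (twist n * i + j)

/-- Inverses of normal forms. -/
def inv : SemiDihedral n → SemiDihedral n
  | a i => a (-i)
  | ba i => ba (-(twist n * i))

instance : Group (SemiDihedral n) where
  mul := mul
  one := a 0
  inv := inv
  mul_assoc := by
    rintro (x | x) (y | y) (z | z)
    · exact congrArg a (by ring)
    · exact congrArg ba (by ring)
    · exact congrArg ba (by ring)
    · exact congrArg a (by rw [mul_add, twist_twist]; ring)
    · exact congrArg ba (by ring)
    · exact congrArg a (by ring)
    · exact congrArg a (by ring)
    · exact congrArg ba (by rw [mul_add, twist_twist]; ring)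
  one_mul := by
    rintro (x | x)
    · exact congrArg a (zero_add x)
    · exact congrArg ba (by ring)
  mul_one := by
    rintro (x | x)
    · exact congrArg a (add_zero x)
    · exact congrArg ba (add_zero x)
  inv_mul_cancel := by
    rintro (x | x)
    · exact congrArg a (neg_add_cancel x)
    · exact congrArg a (by rw [mul_neg, twist_twist, neg_add_cancel])

theorem one_def : (1 : SemiDihedral n) = a 0 := rfl
theorem a_mul_a (i j : ZMod (4 * n)) : a i * a j = a (i + j) := rfl
theorem a_mul_ba (i j : ZMod (4 * n)) : a i * ba j = ba (twist n * i + j) := rfl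
theorem ba_mul_a (i j : ZMod (4 * n)) : ba i * a j = ba (i + j) := rfl
theorem ba_mul_ba (i j : ZMod (4 * n)) : ba i * ba j = a (twist n * i + j) := rfl

/-- The normal forms are two copies of `ℤ/4nℤ`. -/
def equivSum (n : ℕ) : ZMod (4 * n) ⊕ ZMod (4 * n) ≃ SemiDihedral n where
  toFun := Sum.elim a ba
  invFun
    | a i => Sum.inl i
    | ba i => Sum.inr i
  left_inv := by rintro (x | x) <;> rfl
  right_inv := by rintro (x | x) <;> rfl

instance [NeZero n] : Fintype (SemiDihedral n) := Fintype.ofEquiv _ (equivSum n)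

/-- The embedding `T : SD_{8n} ↪ S_{4n}`, where `S_{4n}` permutes the residues modulo `4n`:
`T(a)(t) = t + 1` and `T(b)(t) = (2n - 1) t`. -/
def embed (n : ℕ) : SemiDihedral n →* Equiv.Perm (ZMod (4 * n)) where
  toFun
    | a i => ⟨fun t => t + i, fun t => t - i, fun t => by ring, fun t => by ring⟩
    | ba i => ⟨fun t => twist n * (t + i), fun t => twist n * t - i,
        fun t => by simp [twist_twist], fun t => by simp [twist_twist]⟩
  map_one' := Equiv.ext fun t => add_zero t
  map_mul' := by
    rintro (x | x) (y | y) <;> refine Equiv.ext fun t => ?_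
    · change t + (x + y) = t + y + x
      ring
    · change twist n * (t + (twist n * x + y)) = twist n * (t + y) + x
      linear_combination twist_twist x
    · change twist n * (t + (x + y)) = twist n * (t + y + x)
      ring
    · change t + (twist n * x + y) = twist n * (twist n * (t + y) + x)
      linear_combination -twist_twist (t + y)

/-- For `n ≥ 2` this is an embedding, so that `SD_{8n}` is a subgroup of `S_{4n}`. -/
theorem embed_injective (hn : 2 ≤ n) : Function.Injective (embed n) := by
  rw [injective_iff_map_eq_one]
  rintro (x | x) h
  · have h0 : (0 : ZMod (4 * n)) + x = 0 := Equiv.congr_fun h 0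
    rw [zero_add] at h0
    rw [h0]; rfl
  · exfalso
    have h0 : twist n * (0 + x) = 0 := Equiv.congr_fun h 0
    have h1 : twist n * (1 + x) = 1 := Equiv.congr_fun h 1
    have h2 : ((2 * n - 2 : ℕ) : ZMod (4 * n)) = 0 := by
      rw [Nat.cast_sub (by omega)]
      push_cast
      unfold twist at h0 h1
      linear_combination h1 - h0
    rw [ZMod.natCast_eq_zero_iff] at h2
    exact absurd (Nat.le_of_dvd (by omega) h2) (by omega)

/-- The representation `ρ^h` of degree two: with `ω = exp(iπ/2n)`,
`ρ^h(a^r) = diag(ω^{hr}, ω^{(2n-1)hr})`, and `ρ^h(b a^r)` has the antidiagonal entries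
`ω^{(2n-1)hr}` (above) and `ω^{hr}` (below). Here `ZMod.stdAddChar` is `r ↦ ω^r` on `ℤ/4nℤ`. -/
noncomputable def rho (n : ℕ) [NeZero n] (h : ℕ) : SemiDihedral n →* Matrix (Fin 2) (Fin 2) ℂ where
  toFun
    | a r => !![ZMod.stdAddChar ((h : ZMod (4 * n)) * r), 0;
                0, ZMod.stdAddChar (twist n * (h : ZMod (4 * n)) * r)]
    | ba r => !![0, ZMod.stdAddChar (twist n * (h : ZMod (4 * n)) * r);
                 ZMod.stdAddChar ((h : ZMod (4 * n)) * r), 0]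
  map_one' := by
    change !![_, _; _, _] = _
    simp [Matrix.one_fin_two]
  map_mul' := by
    rintro (x | x) (y | y)
    · change !![_, _; _, _] = !![_, _; _, _] * !![_, _; _, _]
      simp [mul_add, AddChar.map_add_eq_mul]
    · change !![_, _; _, _] = !![_, _; _, _] * !![_, _; _, _]
      have e1 : (h : ZMod (4 * n)) * (twist n * x + y) = twist n * h * x + h * y := by ring
      have e2 : twist n * (h : ZMod (4 * n)) * (twist n * x + y)
          = h * x + twist n * h * y := by
        linear_combination (h : ZMod (4 * n)) * twist_twist x
      simp [e1, e2, AddChar.map_add_eq_mul]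
    · change !![_, _; _, _] = !![_, _; _, _] * !![_, _; _, _]
      simp [mul_add, AddChar.map_add_eq_mul]
    · change !![_, _; _, _] = !![_, _; _, _] * !![_, _; _, _]
      have e1 : (h : ZMod (4 * n)) * (twist n * x + y) = twist n * h * x + h * y := by ring
      have e2 : twist n * (h : ZMod (4 * n)) * (twist n * x + y)
          = h * x + twist n * h * y := by
        linear_combination (h : ZMod (4 * n)) * twist_twist x
      simp [e1, e2, AddChar.map_add_eq_mul]

/-- The character `ς_h` of `ρ^h`. -/
noncomputable def varsigma (n : ℕ) [NeZero n] (h : ℕ) (g : SemiDihedral n) : ℂ :=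
  (rho n h g).trace

/-- `C₁ = {0, 2, 4, …, 2n}`. -/
def C₁ (n : ℕ) : Set ℕ := {h | Even h ∧ h ≤ 2 * n}

/-- `C†_even = C₁ ∖ {0, 2n}`. -/
def CDaggerEven (n : ℕ) : Set ℕ := C₁ n \ {0, 2 * n}

end SemiDihedral

namespace SymmetryClass

section TensorInner

variable {ι : Type*} [Fintype ι] [DecidableEq ι]
  {V : Type*} [NormedAddCommGroup V] [InnerProductSpace ℂ V] [FiniteDimensional ℂ V]

/-- The inner product that `V` induces on `⨂ V`, in coordinates with respect to the tensor
products of the vectors of an orthonormal basis of `V`. By `tensorInner_tprod` it does not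
depend on that basis. -/
noncomputable def tensorInner (x y : ⨂[ℂ] _ : ι, V) : ℂ :=
  ∑ α : ι → Fin (Module.finrank ℂ V),
    starRingEnd ℂ
        ((Basis.piTensorProduct fun _ : ι => (stdOrthonormalBasis ℂ V).toBasis).repr x α) *
      (Basis.piTensorProduct fun _ : ι => (stdOrthonormalBasis ℂ V).toBasis).repr y α

/-- The induced inner product is determined by `⟨⊗ vᵢ, ⊗ uᵢ⟩ = ∏ ⟨vᵢ, uᵢ⟩`. -/
theorem tensorInner_tprod (v u : ι → V) :
    tensorInner (PiTensorProduct.tprod ℂ v) (PiTensorProduct.tprod ℂ u)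
      = ∏ i, inner ℂ (v i) (u i) := by
  unfold tensorInner
  simp only [Basis.piTensorProduct_repr_tprod_apply, OrthonormalBasis.coe_toBasis_repr_apply,
    map_prod, ← Finset.prod_mul_distrib]
  have key : ∀ i, inner ℂ (v i) (u i) = ∑ k,
      starRingEnd ℂ ((stdOrthonormalBasis ℂ V).repr (v i) k)
        * (stdOrthonormalBasis ℂ V).repr (u i) k := by
    intro i
    rw [← (stdOrthonormalBasis ℂ V).repr.inner_map_map, PiLp.inner_apply]
    exact Finset.sum_congr rfl fun k _ => by rw [RCLike.inner_apply, mul_comm]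
  simp only [key]
  rw [Finset.prod_univ_sum, Fintype.piFinset_univ]

end TensorInner

variable {G : Type*} [Group G] [Fintype G] {ι : Type*}
  {V : Type*} [NormedAddCommGroup V] [InnerProductSpace ℂ V]

/-- `P_σ (v₁ ⊗ ⋯ ⊗ v_m) = v_{σ⁻¹(1)} ⊗ ⋯ ⊗ v_{σ⁻¹(m)}`. -/
noncomputable def permOp (V : Type*) [NormedAddCommGroup V] [InnerProductSpace ℂ V]
    (σ : Equiv.Perm ι) : (⨂[ℂ] _ : ι, V) →ₗ[ℂ] (⨂[ℂ] _ : ι, V) :=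
  (PiTensorProduct.reindex ℂ (fun _ : ι => V) σ).toLinearMap

theorem permOp_tprod (σ : Equiv.Perm ι) (v : ι → V) :
    permOp V σ (PiTensorProduct.tprod ℂ v) = PiTensorProduct.tprod ℂ fun i => v (σ⁻¹ i) :=
  PiTensorProduct.reindex_tprod σ v

/-- The symmetry operator `T(G, χ) = (χ(1) / |G|) ∑_{g ∈ G} χ(g) P_g` of the group `G` of
permutations of `ι`, embedded by `T`. -/
noncomputable def symmetryOp (V : Type*) [NormedAddCommGroup V] [InnerProductSpace ℂ V]
    (T : G →* Equiv.Perm ι) (χ : G → ℂ) : (⨂[ℂ] _ : ι, V) →ₗ[ℂ] (⨂[ℂ] _ : ι, V) :=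
  (χ 1 / (Fintype.card G : ℂ)) • ∑ g : G, χ g • permOp V (T g)

/-- The symmetry class of tensors `V_χ(G)`. -/
noncomputable def symmetryClass (V : Type*) [NormedAddCommGroup V] [InnerProductSpace ℂ V]
    (T : G →* Equiv.Perm ι) (χ : G → ℂ) : Submodule ℂ (⨂[ℂ] _ : ι, V) :=
  LinearMap.range (symmetryOp V T χ)

/-- The decomposable symmetrized tensor `e*_α = e_{α₁} * ⋯ * e_{α_m}`. -/
noncomputable def eStar {κ : Type*} (T : G →* Equiv.Perm ι) (χ : G → ℂ) (e : κ → V)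
    (α : ι → κ) : ⨂[ℂ] _ : ι, V :=
  symmetryOp V T χ (PiTensorProduct.tprod ℂ fun i => e (α i))

/-- `V_χ(G)` has an orthogonal `*`-basis with respect to `e`: for some set `S` of multi-indices
the tensors `e*_α`, `α ∈ S`, are pairwise orthogonal and form a basis of `V_χ(G)`. -/
def HasOrthogonalStarBasis [Fintype ι] [DecidableEq ι] [FiniteDimensional ℂ V] {κ : Type*}
    (T : G →* Equiv.Perm ι) (χ : G → ℂ) (e : κ → V) : Prop :=
  ∃ (S : Set (ι → κ)) (B : Module.Basis S ℂ (symmetryClass V T χ)),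
    (∀ α : S, (B α : ⨂[ℂ] _ : ι, V) = eStar T χ e α) ∧
    ∀ α β : S, α ≠ β → tensorInner (B α : ⨂[ℂ] _ : ι, V) (B β : ⨂[ℂ] _ : ι, V) = 0

end SymmetryClass

namespace SemiDihedral

variable {n : ℕ}

/-! Everything reduces to whether `ς_h` has a zero on `⟨a⟩`. Since `ς_h` vanishes off `⟨a⟩`, the
tensor `e*_α` is a sum over the `⟨a⟩`-orbit of `α` weighted by cosines, and `tensorInner_eStar`
gives `⟨e*_α, e*_β⟩` as `1/4n` times the sum of `ς_h(a^m)` over the `m` with `a^m α = β`. In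
particular different orbits are orthogonal.

If `ς_h(a^r) = 0`, then `e*_α` and `e*_{a^r α}` are orthogonal and, like cosine and sine, span all
of the orbit's tensors; the nonzero ones among these pairs form the basis. If there is no zero, a
multi-index with free orbit has tensors no two of which are orthogonal, so at most one is in the
basis; but the Gram determinant of two consecutive ones is a multiple of `4 - ς_h(a)² ≠ 0`, so one
is not enough.

Finally `ς_h(a^r) = 2cos(hrπ/2n)` vanishes iff `hr ≡ n` modulo `2n`, and this is solvable in `r` iff
the 2-part of `h` divides `n`. -/

theorem twist_mul_even {h : ℕ} (hh : Even h) : twist n * (h : ZMod (4 * n)) = -h := by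
  obtain ⟨k, rfl⟩ := hh
  have h4 : (4 : ZMod (4 * n)) * n = 0 := by
    have := ZMod.natCast_self (4 * n)
    push_cast at this
    exact this
  unfold twist
  push_cast
  linear_combination (k : ZMod (4 * n)) * h4

/-! ### The character on `⟨a⟩`: cosine identities and zeros -/

section Character

variable [NeZero n] {h : ℕ}

theorem varsigma_ba (i : ZMod (4 * n)) : varsigma n h (ba i) = 0 := by
  change Matrix.trace !![_, _; _, _] = 0
  simp [Matrix.trace_fin_two]

/-- For even `h` the twist acts on `h` as `-1`, so the two eigenvalues are inverse to each other. -/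
theorem varsigma_a (hh : Even h) (i : ZMod (4 * n)) :
    varsigma n h (a i) = ZMod.stdAddChar ((h : ZMod (4 * n)) * i)
      + ZMod.stdAddChar (-((h : ZMod (4 * n)) * i)) := by
  change Matrix.trace !![_, _; _, _] = _
  rw [Matrix.trace_fin_two, twist_mul_even hh]
  simp

theorem varsigma_a_zero : varsigma n h (a 0) = 2 := by
  change Matrix.trace !![_, _; _, _] = _
  rw [Matrix.trace_fin_two]
  simp
  norm_num

/-- The product-to-sum formula for cosines; it drives all later computations. -/
theorem varsigma_a_mul (hh : Even h) (i j : ZMod (4 * n)) :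
    varsigma n h (a i) * varsigma n h (a j)
      = varsigma n h (a (i + j)) + varsigma n h (a (i - j)) := by
  simp only [varsigma_a hh, sub_eq_add_neg, mul_add, mul_neg, neg_add, neg_neg,
    AddChar.map_add_eq_mul]
  ring

theorem varsigma_a_neg (hh : Even h) (i : ZMod (4 * n)) :
    varsigma n h (a (-i)) = varsigma n h (a i) := by
  simp [varsigma_a hh, add_comm]

theorem conj_varsigma_a (hh : Even h) (i : ZMod (4 * n)) :
    starRingEnd ℂ (varsigma n h (a i)) = varsigma n h (a i) := by
  simp [varsigma_a hh, ← AddChar.map_neg_eq_conj, add_comm]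

theorem stdAddChar_two_mul (hn : n ≠ 0) :
    (ZMod.stdAddChar (2 * n : ZMod (4 * n)) : ℂ) = -1 := by
  have key := ZMod.stdAddChar_coe (N := 4 * n) (2 * n : ℤ)
  push_cast at key
  rw [key]
  have : (n : ℂ) ≠ 0 := by exact_mod_cast hn
  rw [show 2 * (Real.pi : ℂ) * Complex.I * (2 * n) / (4 * n) = Real.pi * Complex.I by
    field_simp; ring, Complex.exp_pi_mul_I]

/-- `ς_h(a^r)` vanishes exactly when `h r` is an odd multiple of `n`. -/
theorem varsigma_a_eq_zero_iff (hh : Even h) (r : ZMod (4 * n)) :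
    varsigma n h (a r) = 0 ↔ 2 * ((h : ZMod (4 * n)) * r) = 2 * n := by
  rw [varsigma_a hh, ← (ZMod.injective_stdAddChar (N := 4 * n)).eq_iff,
    stdAddChar_two_mul (NeZero.ne n), two_mul, AddChar.map_add_eq_mul, AddChar.map_neg_eq_inv]
  have hz := ((ZMod.stdAddChar (N := 4 * n)).val_isUnit ((h : ZMod (4 * n)) * r)).ne_zero
  field_simp
  rw [mul_zero, ← eq_neg_iff_add_eq_zero]

theorem exists_varsigma_a_eq_zero_iff (hh : Even h) (h0 : h ≠ 0) :
    (∃ r : ZMod (4 * n), varsigma n h (a r) = 0) ↔ ∀ k : ℕ, 2 ^ k ∣ h → 2 ^ k ∣ n := by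
  simp only [varsigma_a_eq_zero_iff hh]
  constructor
  · rintro ⟨r, hr⟩ k hk
    obtain ⟨z, rfl⟩ := ZMod.intCast_surjective r
    have h1 : ((2 * (h * z) - 2 * n : ℤ) : ZMod (4 * n)) = 0 := by
      push_cast; rw [hr, sub_self]
    rw [ZMod.intCast_zmod_eq_zero_iff_dvd] at h1
    obtain ⟨y, hy⟩ := h1
    push_cast at hy
    have hy' : (n : ℤ) = h * z - 2 * n * y := by linarith
    -- The factor 2 in `2ny` lets the exponent climb: if `2^j` divides `n`, then `2^(j+1)` divides
    -- both `hz` and `2ny`, hence `n`.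
    have hind : ∀ j ≤ k, 2 ^ j ∣ n := by
      intro j
      induction j with
      | zero => simp
      | succ j ih =>
        intro hj
        obtain ⟨m, hm⟩ := ih (by omega)
        have d1 : (2 ^ (j + 1) : ℤ) ∣ h := by
          exact_mod_cast (pow_dvd_pow 2 hj).trans hk
        have d2 : (2 ^ (j + 1) : ℤ) ∣ 2 * n * y :=
          ⟨m * y, by rw [hm]; push_cast; ring⟩
        have : (2 ^ (j + 1) : ℤ) ∣ n := by
          rw [hy']; exact dvd_sub (d1.mul_right z) d2
        exact_mod_cast this
    exact hind k le_rfl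
  · intro H
    obtain ⟨k, m, hm, hkm⟩ := Nat.exists_eq_two_pow_mul_odd h0
    obtain ⟨q, hq⟩ := H k ⟨m, hkm⟩
    obtain ⟨l, hl⟩ := hm
    -- With `h = 2^k m`, `m` odd, and `n = 2^k q`, the product `hq = nm` is an odd multiple of `n`.
    refine ⟨(q : ZMod (4 * n)), ?_⟩
    have h4 : (4 : ZMod (4 * n)) * n = 0 := by
      have := ZMod.natCast_self (4 * n)
      push_cast at this
      exact this
    have e : h * q = n * (2 * l + 1) := by
      rw [hkm, hl]
      conv_rhs => rw [hq]
      ring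
    have e' : (h : ZMod (4 * n)) * q = n * (2 * l + 1) := by exact_mod_cast congrArg _ e
    rw [e']
    linear_combination (l : ZMod (4 * n)) * h4

/-- Equality would force `ω^{2h} = 1`, that is `4n ∣ 2h`, which `0 < h < 2n` excludes. -/
theorem varsigma_a_one_sq_ne (hh : h ∈ CDaggerEven n) : varsigma n h (a 1) ^ 2 ≠ 4 := by
  obtain ⟨⟨he, hle⟩, hne⟩ := hh
  simp only [Set.mem_insert_iff, Set.mem_singleton_iff, not_or] at hne
  intro H
  rw [varsigma_a he, mul_one, AddChar.map_neg_eq_inv] at H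
  have hz := ((ZMod.stdAddChar (N := 4 * n)).val_isUnit (h : ZMod (4 * n))).ne_zero
  have h1 : (ZMod.stdAddChar (N := 4 * n) (h : ZMod (4 * n)) ^ 2 - 1) ^ 2 = 0 := by
    field_simp at H
    linear_combination H
  have h2 : ZMod.stdAddChar (N := 4 * n) ((2 * h : ℕ) : ZMod (4 * n))
      = ZMod.stdAddChar (N := 4 * n) 0 := by
    push_cast
    rw [AddChar.map_zero_eq_one, two_mul, AddChar.map_add_eq_mul]
    linear_combination pow_eq_zero_iff (two_ne_zero) |>.mp h1
  have h3 := ZMod.injective_stdAddChar h2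
  rw [ZMod.natCast_eq_zero_iff] at h3
  have := Nat.le_of_dvd (by omega) h3
  omega

/-- Translating `i` by one moves the argument by 2, so multiplying the sum by `ς_h(a²)` doubles it,
while `ς_h(a²) ≠ 2`. -/
theorem sum_varsigma_a_two_mul_sub (hh : h ∈ CDaggerEven n) (m : ZMod (4 * n)) :
    ∑ i, varsigma n h (a (2 * i - m)) = 0 := by
  have he := hh.1.1
  have e1 : ∑ i, varsigma n h (a (2 * i - m + 2)) = ∑ i, varsigma n h (a (2 * i - m)) :=
    Fintype.sum_equiv (Equiv.addRight 1) _ _ fun i => by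
      simp only [Equiv.coe_addRight]; congr 2; ring
  have e2 : ∑ i, varsigma n h (a (2 * i - m - 2)) = ∑ i, varsigma n h (a (2 * i - m)) :=
    Fintype.sum_equiv (Equiv.subRight 1) _ _ fun i => by
      simp only [Equiv.subRight_apply]; congr 2; ring
  have e3 : (∑ i, varsigma n h (a (2 * i - m))) * varsigma n h (a 2)
      = 2 * ∑ i, varsigma n h (a (2 * i - m)) := by
    rw [Finset.sum_mul]
    simp only [varsigma_a_mul he, Finset.sum_add_distrib, e1, e2]
    ring
  have e4 : varsigma n h (a 1) ^ 2 = varsigma n h (a 2) + 2 := by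
    rw [sq, varsigma_a_mul he, sub_self, varsigma_a_zero, one_add_one_eq_two]
  have e5 := varsigma_a_one_sq_ne hh
  rw [e4] at e5
  by_contra H
  have : varsigma n h (a 2) = 2 := mul_left_cancel₀ H (by rw [e3]; ring)
  exact e5 (by rw [this]; norm_num)

/-- `ς_h` restricted to `⟨a⟩` reproduces itself under convolution. -/
theorem sum_varsigma_a_mul_sub (hh : h ∈ CDaggerEven n) (m : ZMod (4 * n)) :
    ∑ i, varsigma n h (a i) * varsigma n h (a (i - m)) = 4 * n * varsigma n h (a m) := by
  have he := hh.1.1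
  have : ∀ i : ZMod (4 * n), varsigma n h (a i) * varsigma n h (a (i - m))
      = varsigma n h (a (2 * i - m)) + varsigma n h (a m) := fun i => by
    rw [varsigma_a_mul he, sub_sub_cancel, two_mul, add_sub_assoc]
  simp only [this, Finset.sum_add_distrib, sum_varsigma_a_two_mul_sub hh, zero_add,
    Finset.sum_const, Finset.card_univ, ZMod.card, nsmul_eq_mul]
  push_cast
  rfl

end Character

theorem card_eq [NeZero n] : Fintype.card (SemiDihedral n) = 8 * n := by
  rw [← Fintype.card_congr (equivSum n), Fintype.card_sum, ZMod.card]
  ring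

theorem padicValRat_div_neg_iff (hn : n ≠ 0) {h : ℕ} (h0 : h ≠ 0) :
    padicValRat 2 ((h : ℚ) / (2 * n)) < 0 ↔ ∀ k : ℕ, 2 ^ k ∣ h → 2 ^ k ∣ n := by
  have : Fact (Nat.Prime 2) := ⟨Nat.prime_two⟩
  have hq : (h : ℚ) ≠ 0 := by exact_mod_cast h0
  have hnq : (n : ℚ) ≠ 0 := by exact_mod_cast hn
  rw [padicValRat.div hq (by positivity), padicValRat.mul two_ne_zero hnq,
    padicValRat.of_nat, padicValRat.of_nat]
  have h2 : padicValRat 2 (2 : ℚ) = 1 := by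
    exact_mod_cast padicValRat.self (p := 2) (by norm_num)
  rw [h2]
  simp only [padicValNat_dvd_iff_le h0, padicValNat_dvd_iff_le hn]
  constructor
  · intro H k hk; omega
  · intro H
    have := H _ le_rfl
    omega

end SemiDihedral

/-! ### The induced inner product and the span of the symmetrized tensors -/

namespace SymmetryClass

section TensorInner

variable {ι : Type*} [Fintype ι] [DecidableEq ι]
  {V : Type*} [NormedAddCommGroup V] [InnerProductSpace ℂ V] [FiniteDimensional ℂ V]

theorem tensorInner_smul_right (k : ℂ) (x y : ⨂[ℂ] _ : ι, V) :
    tensorInner x (k • y) = k * tensorInner x y := by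
  simp only [tensorInner, map_smul, Finsupp.smul_apply, smul_eq_mul, Finset.mul_sum]
  exact Finset.sum_congr rfl fun _ _ => by ring

theorem conj_tensorInner (x y : ⨂[ℂ] _ : ι, V) :
    starRingEnd ℂ (tensorInner x y) = tensorInner y x := by
  simp only [tensorInner, map_sum, map_mul, Complex.conj_conj, mul_comm]

theorem tensorInner_smul_left (k : ℂ) (x y : ⨂[ℂ] _ : ι, V) :
    tensorInner (k • x) y = starRingEnd ℂ k * tensorInner x y := by
  rw [← conj_tensorInner, tensorInner_smul_right, map_mul, conj_tensorInner]

theorem tensorInner_sum_right {J : Type*} (s : Finset J) (x : ⨂[ℂ] _ : ι, V)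
    (y : J → ⨂[ℂ] _ : ι, V) : tensorInner x (∑ j ∈ s, y j) = ∑ j ∈ s, tensorInner x (y j) := by
  simp only [tensorInner, map_sum, Finsupp.coe_finsetSum, Finset.sum_apply, Finset.mul_sum]
  exact Finset.sum_comm

theorem tensorInner_sum_left {J : Type*} (s : Finset J) (x : J → ⨂[ℂ] _ : ι, V)
    (y : ⨂[ℂ] _ : ι, V) : tensorInner (∑ j ∈ s, x j) y = ∑ j ∈ s, tensorInner (x j) y := by
  simp only [← conj_tensorInner y, tensorInner_sum_right, map_sum]

theorem tensorInner_self_eq_zero {x : ⨂[ℂ] _ : ι, V} : tensorInner x x = 0 ↔ x = 0 := by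
  constructor
  · intro h
    apply (Basis.piTensorProduct fun _ : ι => (stdOrthonormalBasis ℂ V).toBasis).repr.injective
    rw [map_zero]
    ext α
    simp only [tensorInner, ← Complex.normSq_eq_conj_mul_self] at h
    norm_cast at h
    rw [Finset.sum_eq_zero_iff_of_nonneg fun _ _ => Complex.normSq_nonneg _] at h
    simpa using h α (Finset.mem_univ α)
  · rintro rfl
    simp [tensorInner]

theorem tensorInner_tprod_orthonormal {κ : Type*} [DecidableEq κ] {e : κ → V}
    (he : Orthonormal ℂ e) (α β : ι → κ) :
    tensorInner (PiTensorProduct.tprod ℂ fun i => e (α i)) (PiTensorProduct.tprod ℂ fun i => e (β i))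
      = if α = β then 1 else 0 := by
  rw [tensorInner_tprod]
  simp only [orthonormal_iff_ite.mp he]
  split_ifs with h
  · simp [h]
  · obtain ⟨i, hi⟩ := Function.ne_iff.mp h
    exact Finset.prod_eq_zero (Finset.mem_univ i) (if_neg hi)

/-- Nonzero tensors that are pairwise orthogonal are linearly independent. -/
theorem linearIndependent_of_tensorInner_eq_zero {J : Type*} (v : J → ⨂[ℂ] _ : ι, V)
    (h0 : ∀ j, v j ≠ 0) (ho : ∀ i j, i ≠ j → tensorInner (v i) (v j) = 0) :
    LinearIndependent ℂ v := by
  classical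
  rw [linearIndependent_iff']
  intro s g hg i hi
  have h := congrArg (tensorInner (v i)) hg
  rw [tensorInner_sum_right, Finset.sum_eq_single i
    (fun j _ hj => by rw [tensorInner_smul_right, ho i j hj.symm, mul_zero])
    (fun hn => absurd hi hn), tensorInner_smul_right, ← zero_smul ℂ (0 : ⨂[ℂ] _ : ι, V),
    tensorInner_smul_right, zero_mul] at h
  exact (mul_eq_zero.mp h).resolve_right fun H => h0 i (tensorInner_self_eq_zero.mp H)

end TensorInner

section Span

variable {G : Type*} [Group G] [Fintype G] {ι κ : Type*}
  {V : Type*} [NormedAddCommGroup V] [InnerProductSpace ℂ V]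

theorem span_range_eStar [Finite ι] (T : G →* Equiv.Perm ι) (χ : G → ℂ) (e : Module.Basis κ ℂ V) :
    Submodule.span ℂ (Set.range (eStar T χ e)) = symmetryClass V T χ := by
  classical
  have := Fintype.ofFinite ι
  have hE : Set.range (eStar T χ e)
      = symmetryOp V T χ '' Set.range (Basis.piTensorProduct fun _ : ι => e) := by
    rw [← Set.range_comp]
    congr 1
    funext α
    simp [eStar, Basis.piTensorProduct_apply]
  rw [hE, Submodule.span_image, Module.Basis.span_eq, symmetryClass, LinearMap.range_eq_map]

theorem eStar_mem (T : G →* Equiv.Perm ι) (χ : G → ℂ) (e : κ → V) (α : ι → κ) :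
    eStar T χ e α ∈ symmetryClass V T χ := ⟨_, rfl⟩

end Span

end SymmetryClass

/-! ### Orbits of `⟨a⟩` and orthogonal bases -/

namespace SemiDihedral

open SymmetryClass

variable {n : ℕ} {κ : Type*}

/-- The action of `a^j` on multi-indices. -/
def shift (j : ZMod (4 * n)) (α : ZMod (4 * n) → κ) : ZMod (4 * n) → κ := fun t => α (t - j)

theorem shift_shift (i j : ZMod (4 * n)) (α : ZMod (4 * n) → κ) :
    shift i (shift j α) = shift (i + j) α := by
  funext t
  simp only [shift]
  congr 1
  ring

theorem shift_zero (α : ZMod (4 * n) → κ) : shift 0 α = α := by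
  funext t
  simp [shift]

theorem shift_eq_iff {i j : ZMod (4 * n)} {α β : ZMod (4 * n) → κ} :
    shift i α = shift j β ↔ shift (i - j) α = β := by
  constructor <;> intro H
  · have := congrArg (shift (-j)) H
    rwa [shift_shift, shift_shift, neg_add_cancel, shift_zero, neg_add_eq_sub] at this
  · rw [← H, shift_shift, add_sub_cancel]

/-- Multi-indices that differ by a power of `a`. -/
def shiftSetoid (n : ℕ) (κ : Type*) : Setoid (ZMod (4 * n) → κ) where
  r α β := ∃ j, shift j α = β
  iseqv :=
    { refl := fun α => ⟨0, shift_zero α⟩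
      symm := by
        rintro α _ ⟨j, rfl⟩
        exact ⟨-j, by rw [shift_shift, neg_add_cancel, shift_zero]⟩
      trans := by
        rintro α _ _ ⟨j, rfl⟩ ⟨i, rfl⟩
        exact ⟨i + j, (shift_shift i j α).symm⟩ }

variable [NeZero n] {h : ℕ}
  {V : Type*} [NormedAddCommGroup V] [InnerProductSpace ℂ V]

/-- Since `ς_h` vanishes off `⟨a⟩`, only the powers of `a` contribute to `e*_α`. -/
theorem eStar_eq (e : κ → V) (α : ZMod (4 * n) → κ) :
    eStar (embed n) (varsigma n h) e α = (4 * n : ℂ)⁻¹ •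
      ∑ j, varsigma n h (a j) • PiTensorProduct.tprod ℂ fun i => e (shift j α i) := by
  have hn : (n : ℂ) ≠ 0 := Nat.cast_ne_zero.mpr (NeZero.ne n)
  rw [eStar, symmetryOp, LinearMap.smul_apply, LinearMap.sum_apply,
    ← (equivSum n).sum_comp, Fintype.sum_sum_type, card_eq, one_def, varsigma_a_zero]
  have h1 : ∀ i, varsigma n h (equivSum n (Sum.inr i)) = 0 := varsigma_ba
  have h2 : ∀ i, equivSum n (Sum.inl i) = a i := fun _ => rfl
  simp only [h1, h2, zero_smul, LinearMap.zero_apply, Finset.sum_const_zero, add_zero,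
    LinearMap.smul_apply, permOp_tprod]
  congr 1
  push_cast
  field_simp
  norm_num

theorem eStar_shift (e : κ → V) (r : ZMod (4 * n)) (α : ZMod (4 * n) → κ) :
    eStar (embed n) (varsigma n h) e (shift r α) = (4 * n : ℂ)⁻¹ •
      ∑ j, varsigma n h (a (j - r)) • PiTensorProduct.tprod ℂ fun i => e (shift j α i) := by
  rw [eStar_eq]
  congr 1
  exact Fintype.sum_equiv (Equiv.addRight r) _ _ fun j => by
    simp [shift_shift]

/-- If `ς_h(a^r) = 0`, then `e*_α` and `e*_{a^r α}` span the span of the `⟨a⟩`-orbit. -/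
theorem eStar_shift_eq_of_varsigma_eq_zero (hh : Even h) {r : ZMod (4 * n)}
    (hr : varsigma n h (a r) = 0) (e : κ → V) (j : ZMod (4 * n)) (α : ZMod (4 * n) → κ) :
    eStar (embed n) (varsigma n h) e (shift j α)
      = (varsigma n h (a j) / 2) • eStar (embed n) (varsigma n h) e α
        + (varsigma n h (a (j - r)) / 2) • eStar (embed n) (varsigma n h) e (shift r α) := by
  rw [eStar_shift, eStar_shift, eStar_eq, smul_comm _ (4 * n : ℂ)⁻¹, smul_comm _ (4 * n : ℂ)⁻¹,
    ← smul_add]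
  congr 1
  rw [Finset.smul_sum, Finset.smul_sum, ← Finset.sum_add_distrib]
  refine Finset.sum_congr rfl fun m _ => ?_
  rw [smul_smul, smul_smul, ← add_smul]
  congr 1
  -- The coefficients must satisfy `2ς(m - j) = ς(j)ς(m) + ς(j - r)ς(m - r)`: the subtraction
  -- formula for cosine, with the shift by `r` turning cosines into sines up to sign.
  have e1 := varsigma_a_mul hh j m
  have e2 := varsigma_a_mul hh (j - r) (m - r)
  have e3 := varsigma_a_mul hh (j + m - r) r
  have e4 := varsigma_a_neg hh (m - j)
  rw [hr, mul_zero, sub_add_cancel] at e3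
  rw [neg_sub] at e4
  rw [show j - r + (m - r) = j + m - r - r by ring, show j - r - (m - r) = j - m by ring] at e2
  linear_combination -e1 / 2 - e2 / 2 + e3 / 2 - e4

variable [FiniteDimensional ℂ V]

/-- Only pairs with `a^i α = a^j β` contribute; substituting `m = i - j` turns the double sum into
the convolution of `sum_varsigma_a_mul_sub`. -/
theorem tensorInner_eStar [DecidableEq κ] (hh : h ∈ CDaggerEven n) {e : κ → V}
    (he : Orthonormal ℂ e) (α β : ZMod (4 * n) → κ) :
    tensorInner (eStar (embed n) (varsigma n h) e α) (eStar (embed n) (varsigma n h) e β)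
      = (4 * n : ℂ)⁻¹ * ∑ m, if shift m α = β then varsigma n h (a m) else 0 := by
  have hn : (n : ℂ) ≠ 0 := Nat.cast_ne_zero.mpr (NeZero.ne n)
  have key : ∑ i, ∑ j, varsigma n h (a j) * (varsigma n h (a i)
        * if shift i α = shift j β then 1 else 0)
      = 4 * n * ∑ m, if shift m α = β then varsigma n h (a m) else 0 := by
    have : ∀ i, ∑ j, varsigma n h (a j) * (varsigma n h (a i)
          * if shift i α = shift j β then 1 else 0)
        = ∑ m, if shift m α = β then varsigma n h (a i) * varsigma n h (a (i - m)) else 0 :=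
      fun i => Fintype.sum_equiv (Equiv.subLeft i) _ _ fun j => by
        simp only [shift_eq_iff, Equiv.subLeft_apply, sub_sub_cancel]
        split_ifs <;> simp [mul_comm]
    simp only [this]
    rw [Finset.sum_comm, Finset.mul_sum]
    refine Finset.sum_congr rfl fun m _ => ?_
    split_ifs
    · exact sum_varsigma_a_mul_sub hh m
    · simp
  rw [eStar_eq, eStar_eq, tensorInner_smul_left, tensorInner_smul_right, tensorInner_sum_left]
  simp only [tensorInner_smul_left, tensorInner_sum_right, tensorInner_smul_right,
    tensorInner_tprod_orthonormal he, conj_varsigma_a hh.1.1]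
  rw [key]
  simp only [map_inv₀, map_mul, map_ofNat, Complex.conj_natCast]
  field_simp

/-- The stabilizer of `α` is closed under negation, and the terms at `k` and `-k` add up to
`ς(r)ς(k) = 0`; so the sum equals its own negative. -/
theorem tensorInner_eStar_shift_eq_zero (hh : h ∈ CDaggerEven n) {e : κ → V}
    (he : Orthonormal ℂ e) {r : ZMod (4 * n)} (hr : varsigma n h (a r) = 0)
    (α : ZMod (4 * n) → κ) :
    tensorInner (eStar (embed n) (varsigma n h) e α)
      (eStar (embed n) (varsigma n h) e (shift r α)) = 0 := by
  classical
  rw [tensorInner_eStar hh he]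
  simp only [shift_eq_iff]
  have e1 : ∑ m, (if shift (m - r) α = α then varsigma n h (a m) else 0)
      = ∑ k, if shift k α = α then varsigma n h (a (r + k)) else 0 :=
    Fintype.sum_equiv (Equiv.subRight r) _ _ fun m => by simp
  have e2 : ∑ m, (if shift (m - r) α = α then varsigma n h (a m) else 0)
      = ∑ k, if shift k α = α then varsigma n h (a (r - k)) else 0 :=
    Fintype.sum_equiv (Equiv.subLeft r) _ _ fun m => by
      have : shift (m - r) α = α ↔ shift (r - m) α = α := by
        rw [← shift_eq_iff, eq_comm, shift_eq_iff]
      simp [this]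
  have e3 : ∑ k, (if shift k α = α then varsigma n h (a (r + k)) else 0)
      + ∑ k, (if shift k α = α then varsigma n h (a (r - k)) else 0) = 0 := by
    rw [← Finset.sum_add_distrib]
    refine Finset.sum_eq_zero fun k _ => ?_
    split_ifs
    · rw [← varsigma_a_mul hh.1.1, hr, zero_mul]
    · simp
  rw [← e1, ← e2] at e3
  rw [self_eq_neg.mp (eq_neg_of_add_eq_zero_left e3), mul_zero]

theorem hasOrthogonalStarBasis_of_varsigma_eq_zero [Finite κ] (hh : h ∈ CDaggerEven n)
    {r : ZMod (4 * n)} (hr : varsigma n h (a r) = 0) (e : Module.Basis κ ℂ V)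
    (he : Orthonormal ℂ e) :
    HasOrthogonalStarBasis (embed n) (varsigma n h) e := by
  classical
  let rep : (ZMod (4 * n) → κ) → (ZMod (4 * n) → κ) :=
    fun α => (Quotient.mk (shiftSetoid n κ) α).out
  have hrep : ∀ α, ∃ j, shift j (rep α) = α := fun α =>
    (Quotient.mk_out (s := shiftSetoid n κ) α)
  have hrs : ∀ j α, rep (shift j α) = rep α := fun j α =>
    congrArg Quotient.out (Quotient.sound (s := shiftSetoid n κ)
      ((shiftSetoid n κ).symm ⟨j, rfl⟩))
  -- Two candidates per orbit. Zero tensors are discarded, as occur for instance for constant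
  -- multi-indices.
  let S : Set (ZMod (4 * n) → κ) :=
    {β | eStar (embed n) (varsigma n h) e β ≠ 0 ∧ (β = rep β ∨ β = shift r (rep β))}
  have hrep_mem : ∀ α, eStar (embed n) (varsigma n h) e (rep α)
      ∈ Submodule.span ℂ (Set.range fun β : S => eStar (embed n) (varsigma n h) e β) := fun α => by
    obtain ⟨j, hj⟩ := hrep α
    by_cases h0 : eStar (embed n) (varsigma n h) e (rep α) = 0
    · rw [h0]; exact zero_mem _
    · refine Submodule.subset_span ⟨⟨rep α, h0, Or.inl ?_⟩, rfl⟩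
      conv_rhs => rw [← hrs j, hj]
  have hshift_mem : ∀ α, eStar (embed n) (varsigma n h) e (shift r (rep α))
      ∈ Submodule.span ℂ (Set.range fun β : S => eStar (embed n) (varsigma n h) e β) := fun α => by
    obtain ⟨j, hj⟩ := hrep α
    by_cases h0 : eStar (embed n) (varsigma n h) e (shift r (rep α)) = 0
    · rw [h0]; exact zero_mem _
    · refine Submodule.subset_span ⟨⟨shift r (rep α), h0, Or.inr ?_⟩, rfl⟩
      rw [hrs r, ← hrs j (rep α), hj]
  have hspan : Submodule.span ℂ (Set.range fun β : S => eStar (embed n) (varsigma n h) e β)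
      = symmetryClass V (embed n) (varsigma n h) := by
    apply le_antisymm
    · rw [Submodule.span_le]
      rintro _ ⟨β, rfl⟩
      exact eStar_mem _ _ _ _
    · rw [← span_range_eStar _ _ e, Submodule.span_le]
      rintro _ ⟨α, rfl⟩
      obtain ⟨j, hj⟩ := hrep α
      rw [← hj, eStar_shift_eq_of_varsigma_eq_zero hh.1.1 hr]
      exact add_mem (Submodule.smul_mem _ _ (hrep_mem α)) (Submodule.smul_mem _ _ (hshift_mem α))
  have horth : ∀ α β : S, α ≠ β → tensorInner (eStar (embed n) (varsigma n h) e α)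
      (eStar (embed n) (varsigma n h) e β) = 0 := by
    rintro ⟨α, _, hα⟩ ⟨β, _, hβ⟩ hne
    have hne' : α ≠ β := fun H => hne (Subtype.ext H)
    by_cases H : ∃ m, shift m α = β
    · obtain ⟨m, hm⟩ := H
      have hρ : rep β = rep α := by rw [← hm, hrs]
      rw [hρ] at hβ
      have h1 := tensorInner_eStar_shift_eq_zero hh he hr (rep α)
      have h2 := congrArg (starRingEnd ℂ) h1
      rw [conj_tensorInner, map_zero] at h2
      dsimp only
      rcases hα with hα | hα <;> rcases hβ with hβ | hβ
      · exact absurd (hα.trans hβ.symm) hne'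
      · rw [hβ]; rwa [← hα] at h1 ⊢
      · rw [hβ]; rwa [← hα] at h2
      · exact absurd (hα.trans hβ.symm) hne'
    · rw [tensorInner_eStar hh he, Finset.sum_eq_zero, mul_zero]
      exact fun m _ => if_neg fun hm => H ⟨m, hm⟩
  have hli := linearIndependent_of_tensorInner_eq_zero
    (fun β : S => eStar (embed n) (varsigma n h) e β) (fun β => β.2.1) horth
  refine ⟨S, (Module.Basis.span hli).map (LinearEquiv.ofEq _ _ hspan), ?_, ?_⟩
  · intro α
    simp [Module.Basis.span_apply]
  · intro α β hne
    simpa [Module.Basis.span_apply] using horth α β hne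

theorem exists_varsigma_eq_zero_of_hasOrthogonalStarBasis [Finite κ] [Nontrivial κ]
    (hh : h ∈ CDaggerEven n) {e : κ → V} (he : Orthonormal ℂ e)
    (H : HasOrthogonalStarBasis (embed n) (varsigma n h) e) :
    ∃ r : ZMod (4 * n), varsigma n h (a r) = 0 := by
  classical
  have hn : (4 * n : ℂ)⁻¹ ≠ 0 := by simp [NeZero.ne n]
  obtain ⟨S, B, hB, ho⟩ := H
  obtain ⟨p, q, hpq⟩ := exists_pair_ne κ
  by_contra! hc
  -- A single marked position makes the `⟨a⟩`-orbit free, so each inner product within it is a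
  -- single character value.
  let δ : ZMod (4 * n) → κ := fun t => if t = 0 then p else q
  have hδ : ∀ i j, shift i δ = shift j δ ↔ i = j := by
    intro i j
    refine ⟨fun hij => ?_, fun hij => by rw [hij]⟩
    have := congrFun hij i
    simp only [shift, δ, sub_self, if_true] at this
    by_contra hne
    exact hpq (by rwa [if_neg (sub_ne_zero.mpr hne)] at this)
  have hG : ∀ i j, tensorInner (eStar (embed n) (varsigma n h) e (shift i δ))
      (eStar (embed n) (varsigma n h) e (shift j δ))
        = (4 * n : ℂ)⁻¹ * varsigma n h (a (j - i)) := by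
    intro i j
    rw [tensorInner_eStar hh he]
    simp only [shift_shift, hδ, ← eq_sub_iff_add_eq]
    simp
  have hBB : ∀ β, tensorInner (B β : ⨂[ℂ] _ : ZMod (4 * n), V) (B β) ≠ 0 := fun β hβ =>
    B.ne_zero β (Subtype.ext (tensorInner_self_eq_zero.mp hβ))
  have hcoef : ∀ (x : symmetryClass V (embed n) (varsigma n h)) (β : S),
      tensorInner (B β : ⨂[ℂ] _ : ZMod (4 * n), V) x = 0 → B.repr x β = 0 := by
    intro x β hx
    have := Fintype.ofFinite S
    have hsum : (x : ⨂[ℂ] _ : ZMod (4 * n), V) = ∑ γ, B.repr x γ • (B γ : ⨂[ℂ] _, V) := by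
      simpa only [Submodule.coe_sum, Submodule.coe_smul] using
        congrArg Subtype.val (B.sum_repr x).symm
    rw [hsum, tensorInner_sum_right, Finset.sum_eq_single β
      (fun γ _ hγ => by rw [tensorInner_smul_right, ho β γ hγ.symm, mul_zero])
      (fun hβ => absurd (Finset.mem_univ β) hβ), tensorInner_smul_right] at hx
    exact (mul_eq_zero.mp hx).resolve_right (hBB β)
  let x : ZMod (4 * n) → symmetryClass V (embed n) (varsigma n h) := fun i =>
    ⟨eStar (embed n) (varsigma n h) e (shift i δ), eStar_mem _ _ _ _⟩
  have hout : ∀ (i : ZMod (4 * n)) (β : S), (∀ j, (β : ZMod (4 * n) → κ) ≠ shift j δ) →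
      B.repr (x i) β = 0 := by
    intro i β hβ
    apply hcoef
    rw [hB, tensorInner_eStar hh he, Finset.sum_eq_zero, mul_zero]
    intro m _
    refine if_neg fun hm => hβ (i - m) ?_
    rw [eq_comm, ← shift_eq_iff, hm]
  have hx0 : x 0 ≠ 0 := by
    intro hx
    have h1 := hG 0 0
    rw [tensorInner_self_eq_zero.mpr (congrArg Subtype.val hx), sub_self, varsigma_a_zero] at h1
    exact mul_ne_zero hn two_ne_zero h1.symm
  -- Basis members outside the orbit are orthogonal to `x 0 ≠ 0`, so some member lies in the orbit;
  -- without zeros of `ς_h` it is the only one.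
  obtain ⟨β, j, hβ⟩ : ∃ (β : S) (j : ZMod (4 * n)), (β : ZMod (4 * n) → κ) = shift j δ := by
    by_contra! hnone
    exact hx0 (B.ext_elem fun β => by rw [hout 0 β (hnone β), map_zero, Finsupp.zero_apply])
  have huniq : ∀ γ : S, γ ≠ β → ∀ i, (γ : ZMod (4 * n) → κ) ≠ shift i δ := by
    intro γ hne i hγ
    have h1 := ho γ β hne
    rw [hB, hB, hγ, hβ, hG] at h1
    exact mul_ne_zero hn (hc _) h1
  have hmul : ∀ i, (x i : ⨂[ℂ] _ : ZMod (4 * n), V) = B.repr (x i) β • (B β : ⨂[ℂ] _, V) := by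
    intro i
    refine congrArg Subtype.val (B.ext_elem (y := B.repr (x i) β • B β) fun γ => ?_)
    by_cases hγ : γ = β
    · simp [hγ]
    · rw [hout i γ (huniq γ hγ)]
      simp [Ne.symm hγ]
  -- Both vectors are multiples of `B β`, so their Gram determinant vanishes, which says `ς_h(a)² =
  -- 4`.
  have hdet : tensorInner (x 0 : ⨂[ℂ] _ : ZMod (4 * n), V) (x 0)
        * tensorInner (x 1 : ⨂[ℂ] _ : ZMod (4 * n), V) (x 1)
      = tensorInner (x 0 : ⨂[ℂ] _ : ZMod (4 * n), V) (x 1)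
        * tensorInner (x 1 : ⨂[ℂ] _ : ZMod (4 * n), V) (x 0) := by
    rw [hmul 0, hmul 1]
    simp only [tensorInner_smul_left, tensorInner_smul_right]
    ring
  simp only [x, hG, sub_self, sub_zero, zero_sub, varsigma_a_neg hh.1.1, varsigma_a_zero] at hdet
  apply varsigma_a_one_sq_ne hh
  refine mul_left_cancel₀ (mul_ne_zero hn hn) ?_
  linear_combination -hdet

end SemiDihedral

theorem theorem3p4 (n : ℕ) [NeZero n] (hn : 2 ≤ n) (h : ℕ) (hh : h ∈ SemiDihedral.CDaggerEven n)
    {V : Type*} [NormedAddCommGroup V] [InnerProductSpace ℂ V] [FiniteDimensional ℂ V]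
    (hV : 2 ≤ Module.finrank ℂ V) (e : OrthonormalBasis (Fin (Module.finrank ℂ V)) ℂ V) :
    (SymmetryClass.HasOrthogonalStarBasis (SemiDihedral.embed n) (SemiDihedral.varsigma n h) e ↔
      padicValRat 2 ((h : ℚ) / (2 * n)) < 0) ∧
    (padicValRat 2 ((h : ℚ) / (2 * n)) < 0 ↔ ∀ k : ℕ, 2 ^ k ∣ h → 2 ^ k ∣ n) := by
  have h0 : h ≠ 0 := fun H => hh.2 (by simp [H])
  have hval := SemiDihedral.padicValRat_div_neg_iff (NeZero.ne n) h0
  refine ⟨?_, hval⟩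
  rw [hval, ← SemiDihedral.exists_varsigma_a_eq_zero_iff hh.1.1 h0]
  constructor
  · have : Nontrivial (Fin (Module.finrank ℂ V)) := Fin.nontrivial_iff_two_le.mpr hV
    exact SemiDihedral.exists_varsigma_eq_zero_of_hasOrthogonalStarBasis hh e.orthonormal
  · rintro ⟨r, hr⟩
    simpa using SemiDihedral.hasOrthogonalStarBasis_of_varsigma_eq_zero hh hr e.toBasis
      (by simp)
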